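/- Let $R$ be a commutative noetherian ring which is Cohen–Macaulay (i.e. $\operatorname{depth} R_{\mathfrak p}=\dim R_{\mathfrak p}$ for every prime $\mathfrak p$), and let $\omega$ be a canonical module of $R$, i.e. a finitely generated $R$-module such that for every prime $\mathfrak p$ the $R_{\mathfrak p}$-module $\omega_{\mathfrak p}$ is maximal Cohen–Macaulay, of finite injective dimension and of type one. Let $n\ge 0$ be an integer. All modules are finitely generated. Let $C$ be a semidualizing $R$-module: the homothety map $R\to\operatorname{Hom}_R(C,C)$ is an isomorphism and $\operatorname{Ext}^i_R(C,C)=0$ for all $i>0$. We use the following notions. * For $k\ge -1$, $R$ satisfies $(G_k^C)$ if $C_{\mathfrak p}$ has finite injective dimension over $R_{\mathfrak p}$ for every prime $\mathfrak p$ of height at most $k$. * $M$ satisfies $(S_n)$ if $\operatorname{depth} M_{\mathfrak p}\ge\min\{n,\dim R_{\mathfrak p}\}$ for every prime $\mathfrak p$ (with $\operatorname{depth} 0=\infty$); $S_n(R)$ is the class of such modules. * $M$ is an $n$-$C$-syzygy if there is an exact sequence $0\to M\to P_C^1\to P_C^2\to\cdots\to P_C^n$ in which each $P_C^i$ is a direct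 summand of a finite direct sum of copies of $C$ (for $n=0$ every module is one); $\Omega_C^n(\operatorname{mod} R)$ is the class of such modules. **Theorem 4.1.** The following conditions are equivalent: 1. $R$ satisfies $(G_{n-1}^C)$; 2. $S_n(R)=\Omega_C^n(\operatorname{mod} R)$; 3. $\omega\in\Omega_C^n(\operatorname{mod} R)$. In particular, for $C=R$: the ring $R_{\mathfrak p}$ is Gorenstein (i.e. of finite injective dimension over itself) for all primes $\mathfrak p$ of height less than $n$, if and only if $S_n(R)=\Omega_R^n(\operatorname{mod} R)$, if and only if $\omega\in\Omega_R^n(\operatorname{mod} R)$. -/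

import Mathlib

universe u

open CategoryTheory

/-- The depth of a module `M` over a local ring `A`: the supremum of the lengths of `M`-regular
sequences in the maximal ideal. For finitely generated `M ≠ 0` the requirement
`M ≠ (x₁, …, xᵣ) M` holds automatically (Nakayama); for `M = 0` every sequence is weakly regular,
which gives the usual convention `depth 0 = ∞`. -/
noncomputable def localDepth (A : Type u) [CommRing A] [IsLocalRing A]
    (M : Type u) [AddCommGroup M] [Module A M] : ℕ∞ :=
  ⨆ (rs : List A) (_ : ∀ r ∈ rs, r ∈ IsLocalRing.maximalIdeal A)
    (_ : RingTheory.Sequence.IsWeaklyRegular M rs), (rs.length : ℕ∞)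

/-- The module `M` has finite injective dimension over `A`. -/
def HasFiniteInjDim (A : Type u) [CommRing A] (M : Type u) [AddCommGroup M] [Module A M] : Prop :=
  ∃ m : ℕ, HasInjectiveDimensionLE (ModuleCat.of A M) m

/-- A (noetherian) ring is Cohen–Macaulay if `depth R_𝔭 = dim R_𝔭` for all prime ideals `𝔭`. -/
def IsCohenMacaulayRing (R : Type u) [CommRing R] : Prop :=
  ∀ p : PrimeSpectrum R,
    ((localDepth (Localization.AtPrime p.asIdeal) (Localization.AtPrime p.asIdeal) : ℕ∞) :
      WithBot ℕ∞) = ringKrullDim (Localization.AtPrime p.asIdeal)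

/-- Canonical modules of a (Cohen–Macaulay, noetherian) local ring `A` with residue field `k`:
finitely generated maximal Cohen–Macaulay modules of finite injective dimension and of type one,
the type of `W` being `dim_k Ext^t_A(k, W)` with `t = depth W`. -/
structure IsLocalCanonicalModule (A : Type u) [CommRing A] [IsLocalRing A]
    (W : Type u) [AddCommGroup W] [Module A W] : Prop where
  finite : Module.Finite A W
  maximalCohenMacaulay : ((localDepth A W : ℕ∞) : WithBot ℕ∞) = ringKrullDim A
  finiteInjDim : HasFiniteInjDim A W
  type_one : ∃ t : ℕ, localDepth A W = t ∧
    Nonempty (Abelian.Ext (ModuleCat.of A (IsLocalRing.ResidueField A)) (ModuleCat.of A W) t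
      ≃ₗ[A] IsLocalRing.ResidueField A)

/-- A canonical module of a (Cohen–Macaulay) ring `R`: a finitely generated module which is
locally a canonical module. -/
structure IsCanonicalModule (R : Type u) [CommRing R]
    (W : Type u) [AddCommGroup W] [Module R W] : Prop where
  finite : Module.Finite R W
  localCanonical : ∀ p : PrimeSpectrum R,
    IsLocalCanonicalModule (Localization.AtPrime p.asIdeal) (LocalizedModule p.asIdeal.primeCompl W)

/-- Semidualizing modules: finitely generated, the homothety map `R → Hom_R(C, C)` is an
isomorphism, and `Ext^i_R(C, C) = 0` for all `i > 0`. -/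
structure IsSemidualizing (R : Type u) [CommRing R]
    (C : Type u) [AddCommGroup C] [Module R C] : Prop where
  finite : Module.Finite R C
  homothety : Function.Bijective (LinearMap.lsmul R C : R →ₗ[R] C →ₗ[R] C)
  ext_vanishing : ∀ i : ℕ, 0 < i →
    Subsingleton (Abelian.Ext (ModuleCat.of R C) (ModuleCat.of R C) i)

/-- `P` is (isomorphic to) a direct summand of a finite direct sum of copies of `C`. -/
def IsSummandOfCopies (R : Type u) [CommRing R] (C : Type u) [AddCommGroup C] [Module R C]
    (P : Type u) [AddCommGroup P] [Module R P] : Prop :=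
  ∃ (k : ℕ) (i : P →ₗ[R] (Fin k → C)) (r : (Fin k → C) →ₗ[R] P), r ∘ₗ i = LinearMap.id

/-- `M` is an `n`-`C`-syzygy: there is an exact sequence `0 → M → P¹ → ⋯ → Pⁿ` with every `Pⁱ` a
direct summand of a finite direct sum of copies of `C`. Here `P 0` is `M` up to isomorphism, and
the terms `P i` with `i > n` play no role. There is no condition for `n = 0`. -/
def IsCSyzygy (R : Type u) [CommRing R] (C : Type u) [AddCommGroup C] [Module R C] (n : ℕ)
    (M : Type u) [AddCommGroup M] [Module R M] : Prop :=
  ∃ (P : ℕ → ModuleCat.{u} R) (d : ∀ i, P i →ₗ[R] P (i + 1)),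
    Nonempty (M ≃ₗ[R] P 0) ∧
    (∀ i, 1 ≤ i → i ≤ n → IsSummandOfCopies R C (P i)) ∧
    (1 ≤ n → Function.Injective (d 0)) ∧
    (∀ i, i + 1 < n → Function.Exact (d i) (d (i + 1)))

/-- The class `Ω^n_C(mod R)` of finitely generated `n`-`C`-syzygy modules. -/
def cSyzygyClass (R : Type u) [CommRing R] (C : Type u) [AddCommGroup C] [Module R C] (n : ℕ) :
    Set (ModuleCat.{u} R) :=
  {M | Module.Finite R M ∧ IsCSyzygy R C n M}

/-- Serre's condition `(S_n)`: `depth M_𝔭 ≥ min {n, dim R_𝔭}` for all prime ideals `𝔭`. -/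
def SatisfiesSerre (R : Type u) [CommRing R] (n : ℕ)
    (M : Type u) [AddCommGroup M] [Module R M] : Prop :=
  ∀ p : PrimeSpectrum R,
    min (n : WithBot ℕ∞) (ringKrullDim (Localization.AtPrime p.asIdeal)) ≤
      ((localDepth (Localization.AtPrime p.asIdeal) (LocalizedModule p.asIdeal.primeCompl M) : ℕ∞) :
        WithBot ℕ∞)

/-- The class `S_n(R)` of finitely generated modules satisfying `(S_n)`. -/
def serreClass (R : Type u) [CommRing R] (n : ℕ) : Set (ModuleCat.{u} R) :=
  {M | Module.Finite R M ∧ SatisfiesSerre R n M}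

/-- The condition `(G_k^C)`: `C_𝔭` has finite injective dimension over `R_𝔭` for all prime ideals
`𝔭` of height at most `k`. The index is an integer, so that `(G_{-1}^C)` is the empty condition.
(Heights are finite over a noetherian ring.) -/
def SatisfiesG (R : Type u) [CommRing R] (C : Type u) [AddCommGroup C] [Module R C] (k : ℤ) :
    Prop :=
  ∀ (p : PrimeSpectrum R) (h : ℕ), p.asIdeal.height = h → (h : ℤ) ≤ k →
    HasFiniteInjDim (Localization.AtPrime p.asIdeal) (LocalizedModule p.asIdeal.primeCompl C)

/-- A (noetherian) local ring is Gorenstein if it has finite injective dimension over itself. -/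
def IsGorensteinLocal (A : Type u) [CommRing A] : Prop :=
  HasFiniteInjDim A A

/-! Everything reduces to dimension shifting over the local rings `R_𝔭`, with depth read off from
`Ext^i(k, -)` (`le_localDepth_iff`). If `N ≠ 0` is finite of finite injective dimension over a local
ring of depth `d`, then `Ext^i(-, N)` vanishes on finite modules for `i > d`, while `Ext^d(k, N) ≠
0` (`HasFiniteInjDim.extVanishes`, `HasFiniteInjDim.not_extVanishes`).

Syzygies satisfy `(S_n)` by counting depths, since `depth C_𝔭 ≥ depth R_𝔭 = ht 𝔭`. Conversely, let
`f : M → C^k` be a map through which all maps `M → C` factor. Under `(S_1)`, finite injective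
dimension of `C` at minimal primes makes `f` injective (`injective_left_approximation`). If `M`
satisfies `(S_{n+1})`, its cokernel `N` satisfies `(S_n)`: the depth count can fall short by one
only at primes of height at most `n`, and there `Ext^i(N_𝔭, C_𝔭) = 0` for `i > 0` supplies the
missing degree (`HasFiniteInjDim.depth_of_extVanishes`). Induction on `n` then gives the whole
coresolution.

Finally let `0 → ω → P → N → 0` begin a coresolution. At primes of height less than `n`, the depth
of `N_𝔭` forces `Ext¹(N_𝔭, ω_𝔭) = 0`, so the sequence splits and `ω_𝔭` is a summand of copies of
`C_𝔭`. As `End(C_𝔭) = R_𝔭` is local, `C_𝔭` is in turn a summand of `ω_𝔭`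
(`exists_retract_of_sum_eq_id`) and inherits finite injective dimension. -/

/-- Vanishing of `Ext^i_A(M, N)`. -/
abbrev ExtVanishes (A : Type u) [CommRing A] (M N : Type u) [AddCommGroup M] [Module A M]
    [AddCommGroup N] [Module A N] (i : ℕ) : Prop :=
  Subsingleton (Abelian.Ext (ModuleCat.of A M) (ModuleCat.of A N) i)

/-! ### Long exact sequences, phrased as vanishing of `Ext`. -/

section ExtVanishing

variable {A : Type u} [CommRing A]
variable {X Y Z N M : Type u} [AddCommGroup X] [Module A X] [AddCommGroup Y] [Module A Y]
  [AddCommGroup Z] [Module A Z] [AddCommGroup N] [Module A N] [AddCommGroup M] [Module A M]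

theorem extVanishes_iff {i : ℕ} : ExtVanishes A M N i ↔
    ∀ x : Abelian.Ext (ModuleCat.of A M) (ModuleCat.of A N) i, x = 0 :=
  ⟨fun _ x => Subsingleton.elim x 0, subsingleton_of_forall_eq 0⟩

theorem extVanishes_zero_iff : ExtVanishes A M N 0 ↔ Subsingleton (M →ₗ[A] N) :=
  (Abelian.Ext.addEquiv₀.trans ModuleCat.homAddEquiv).subsingleton_congr

theorem shortExact_of_linearMap {f : X →ₗ[A] Y} {g : Y →ₗ[A] Z} (hf : Function.Injective f)
    (hfg : Function.Exact f g) (hg : Function.Surjective g) :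
    (ShortComplex.moduleCatMk f g hfg.linearMap_comp_eq_zero).ShortExact where
  exact := (ShortComplex.ShortExact.moduleCat_exact_iff_function_exact _).mpr hfg
  mono_f := (ModuleCat.mono_iff_injective _).mpr hf
  epi_g := (ModuleCat.epi_iff_surjective _).mpr hg

section Sequence

variable {f : X →ₗ[A] Y} {g : Y →ₗ[A] Z} (hf : Function.Injective f)
    (hfg : Function.Exact f g) (hg : Function.Surjective g)
include hf hfg hg

theorem ExtVanishes.contravariant_middle {i : ℕ} (hZ : ExtVanishes A Z N i)
    (hX : ExtVanishes A X N i) : ExtVanishes A Y N i := by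
  rw [extVanishes_iff] at *
  intro x
  obtain ⟨y, rfl⟩ := Abelian.Ext.contravariant_sequence_exact₂
    (shortExact_of_linearMap hf hfg hg) _ x (hX _)
  have : y = 0 := hZ y
  rw [this, Abelian.Ext.comp_zero]
  rfl

theorem ExtVanishes.contravariant_left {i : ℕ} (hY : ExtVanishes A Y N i)
    (hZ : ExtVanishes A Z N (i + 1)) : ExtVanishes A X N i := by
  rw [extVanishes_iff] at *
  intro x
  obtain ⟨y, rfl⟩ := Abelian.Ext.contravariant_sequence_exact₁
    (shortExact_of_linearMap hf hfg hg) _ x (add_comm 1 i) (hZ _)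
  have : y = 0 := hY y
  rw [this, Abelian.Ext.comp_zero]
  rfl

theorem ExtVanishes.contravariant_right {i : ℕ} (hX : ExtVanishes A X N i)
    (hY : ExtVanishes A Y N (i + 1)) : ExtVanishes A Z N (i + 1) := by
  rw [extVanishes_iff] at *
  intro x
  obtain ⟨y, rfl⟩ := Abelian.Ext.contravariant_sequence_exact₃
    (shortExact_of_linearMap hf hfg hg) _ x (hY _) (add_comm 1 i)
  have : y = 0 := hX y
  rw [this, Abelian.Ext.comp_zero]
  rfl

theorem ExtVanishes.covariant_right {i : ℕ} (hY : ExtVanishes A M Y i)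
    (hX : ExtVanishes A M X (i + 1)) : ExtVanishes A M Z i := by
  rw [extVanishes_iff] at *
  intro x
  obtain ⟨y, rfl⟩ := Abelian.Ext.covariant_sequence_exact₃ _
    (shortExact_of_linearMap hf hfg hg) x rfl (hX _)
  have : y = 0 := hY y
  rw [this, Abelian.Ext.zero_comp]
  rfl

theorem ExtVanishes.covariant_left {i : ℕ} (hZ : ExtVanishes A M Z i)
    (hY : ExtVanishes A M Y (i + 1)) : ExtVanishes A M X (i + 1) := by
  rw [extVanishes_iff] at *
  intro x
  obtain ⟨y, rfl⟩ := Abelian.Ext.covariant_sequence_exact₁ _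
    (shortExact_of_linearMap hf hfg hg) x (hY _) rfl
  have : y = 0 := hZ y
  rw [this, Abelian.Ext.zero_comp]
  rfl

/-- If `Ext¹(Z, N) = 0`, every map `X → N` extends along `X ↪ Y` with cokernel `Z`. -/
theorem ExtVanishes.exists_extension (hZ : ExtVanishes A Z N 1) (φ : X →ₗ[A] N) :
    ∃ ψ : Y →ₗ[A] N, ψ ∘ₗ f = φ := by
  obtain ⟨y, hy⟩ := Abelian.Ext.contravariant_sequence_exact₁ (shortExact_of_linearMap hf hfg hg)
    (ModuleCat.of A N) (Abelian.Ext.mk₀ (ModuleCat.ofHom φ)) (add_comm 1 0)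
    (extVanishes_iff.mp hZ _)
  obtain ⟨ψ, rfl⟩ := (Abelian.Ext.mk₀_bijective _ _).2 y
  rw [Abelian.Ext.mk₀_comp_mk₀] at hy
  have := (Abelian.Ext.mk₀_bijective _ _).1 hy
  exact ⟨ψ.hom, congrArg ModuleCat.Hom.hom this⟩

/-- If `Ext¹(Y, N) = 0` and all maps `X → N` extend to `Y`, then `Ext¹(Z, N) = 0`. -/
theorem ExtVanishes.one_of_forall_extension (hY : ExtVanishes A Y N 1)
    (h : ∀ φ : X →ₗ[A] N, ∃ ψ : Y →ₗ[A] N, ψ ∘ₗ f = φ) : ExtVanishes A Z N 1 := by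
  rw [extVanishes_iff] at *
  intro x
  obtain ⟨y, rfl⟩ := Abelian.Ext.contravariant_sequence_exact₃
    (shortExact_of_linearMap hf hfg hg) _ x (hY _) (add_comm 1 0)
  obtain ⟨φ, rfl⟩ := (Abelian.Ext.mk₀_bijective _ _).2 y
  obtain ⟨ψ, hψ⟩ := h φ.hom
  let ψ' : (ShortComplex.moduleCatMk f g hfg.linearMap_comp_eq_zero).X₂ ⟶ ModuleCat.of A N :=
    ModuleCat.ofHom ψ
  have : φ = (ShortComplex.moduleCatMk f g hfg.linearMap_comp_eq_zero).f ≫ ψ' :=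
    ModuleCat.hom_ext hψ.symm
  rw [this, ← Abelian.Ext.mk₀_comp_mk₀, ← Abelian.Ext.comp_assoc _ _ _ (add_zero 1) (zero_add 0)
    (by simp), ShortComplex.ShortExact.extClass_comp, Abelian.Ext.zero_comp]
  rfl

end Sequence

/-- Vanishing of `Ext^i(C, N)` passes to modules whose identity is a sum of maps factoring
through `C`. -/
theorem ExtVanishes.of_sum_eq_id_left {ι : Type*} [Fintype ι] {P C : Type u} [AddCommGroup P]
    [Module A P] [AddCommGroup C] [Module A C] (s : ι → P →ₗ[A] C) (r : ι → C →ₗ[A] P)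
    (hsr : ∑ j, r j ∘ₗ s j = LinearMap.id) {i : ℕ} (h : ExtVanishes A C N i) :
    ExtVanishes A P N i := by
  rw [extVanishes_iff]
  intro x
  have hid : 𝟙 (ModuleCat.of A P) = ∑ j, ModuleCat.ofHom (s j) ≫ ModuleCat.ofHom (r j) := by
    ext y
    simpa [ModuleCat.hom_sum] using (LinearMap.congr_fun hsr y).symm
  rw [← Abelian.Ext.mk₀_id_comp x, hid, Abelian.Ext.mk₀_sum, Abelian.Ext.sum_comp]
  refine Finset.sum_eq_zero fun j _ => ?_
  rw [← Abelian.Ext.mk₀_comp_mk₀, Abelian.Ext.comp_assoc _ _ _ (zero_add 0) (zero_add i) (by simp),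
    Subsingleton.elim ((Abelian.Ext.mk₀ (ModuleCat.ofHom (r j))).comp x (zero_add i)) 0,
    Abelian.Ext.comp_zero]

/-- Vanishing of `Ext^i(M, C)` passes to modules whose identity is a sum of maps factoring
through `C`. -/
theorem ExtVanishes.of_sum_eq_id_right {ι : Type*} [Fintype ι] {P C : Type u} [AddCommGroup P]
    [Module A P] [AddCommGroup C] [Module A C] (s : ι → P →ₗ[A] C) (r : ι → C →ₗ[A] P)
    (hsr : ∑ j, r j ∘ₗ s j = LinearMap.id) {i : ℕ} (h : ExtVanishes A M C i) :
    ExtVanishes A M P i := by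
  rw [extVanishes_iff]
  intro x
  have hid : 𝟙 (ModuleCat.of A P) = ∑ j, ModuleCat.ofHom (s j) ≫ ModuleCat.ofHom (r j) := by
    ext y
    simpa [ModuleCat.hom_sum] using (LinearMap.congr_fun hsr y).symm
  rw [← Abelian.Ext.comp_mk₀_id x, hid, Abelian.Ext.mk₀_sum, Abelian.Ext.comp_sum]
  refine Finset.sum_eq_zero fun j _ => ?_
  rw [← Abelian.Ext.mk₀_comp_mk₀, ← Abelian.Ext.comp_assoc _ _ _ (add_zero i) (zero_add 0)
    (by simp), Subsingleton.elim (x.comp (Abelian.Ext.mk₀ (ModuleCat.ofHom (s j))) (add_zero i)) 0,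
    Abelian.Ext.zero_comp]

theorem ExtVanishes.congr_left (e : X ≃ₗ[A] Y) {i : ℕ} (h : ExtVanishes A X N i) :
    ExtVanishes A Y N i :=
  h.of_sum_eq_id_left (ι := Unit) (fun _ => e.symm.toLinearMap) (fun _ => e.toLinearMap)
    (by ext; simp)

theorem extVanishes_of_projective [Module.Projective A M] {i : ℕ} (hi : 0 < i) :
    ExtVanishes A M N i := by
  obtain ⟨i, rfl⟩ := Nat.exists_eq_succ_of_ne_zero hi.ne'
  have : Projective (ModuleCat.of A M) := (IsProjective.iff_projective _).mp inferInstance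
  exact Abelian.Ext.subsingleton_of_projective _ _ i

theorem extVanishes_of_subsingleton_right [Subsingleton N] (i : ℕ) : ExtVanishes A M N i := by
  rw [extVanishes_iff]
  intro x
  have : 𝟙 (ModuleCat.of A N) = 0 := by ext y; exact Subsingleton.elim _ _
  rw [← Abelian.Ext.comp_mk₀_id x, this, Abelian.Ext.mk₀_zero, Abelian.Ext.comp_zero]

theorem isSummandOfCopies_pi (C : Type u) [AddCommGroup C] [Module A C] (k : ℕ) :
    IsSummandOfCopies A C (Fin k → C) :=
  ⟨k, LinearMap.id, LinearMap.id, rfl⟩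

theorem IsSummandOfCopies.exists_sum_eq_id {C P : Type u} [AddCommGroup C] [Module A C]
    [AddCommGroup P] [Module A P] (h : IsSummandOfCopies A C P) :
    ∃ (k : ℕ) (s : Fin k → P →ₗ[A] C) (r : Fin k → C →ₗ[A] P),
      ∑ j, r j ∘ₗ s j = LinearMap.id := by
  obtain ⟨k, i, r, h⟩ := h
  refine ⟨k, fun j => LinearMap.proj j ∘ₗ i, fun j => r ∘ₗ LinearMap.single A (fun _ => C) j, ?_⟩
  ext x
  have := LinearMap.congr_fun h x
  simp only [LinearMap.comp_apply, LinearMap.id_apply, LinearMap.sum_apply, LinearMap.proj_apply]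
    at this ⊢
  rw [← map_sum]
  simpa [LinearMap.sum_single_apply] using this

end ExtVanishing

/-! ### Depth and finite injective dimension over a noetherian local ring. -/

section LocalRing

open IsLocalRing
open scoped Pointwise

variable {A : Type u} [CommRing A]
variable {M N : Type u} [AddCommGroup M] [Module A M] [AddCommGroup N] [Module A N]

theorem ext_smul_eq_zero_of_mem_annihilator {x : A} (hx : x ∈ Module.annihilator A M) {i : ℕ}
    (e : Abelian.Ext (ModuleCat.of A M) (ModuleCat.of A N) i) : x • e = 0 := by
  have h : x • 𝟙 (ModuleCat.of A M) = 0 := by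
    ext y
    exact Module.mem_annihilator.mp hx y
  rw [← Abelian.Ext.mk₀_id_comp e, ← Abelian.Ext.smul_comp, ← Abelian.Ext.mk₀_smul, h,
    Abelian.Ext.mk₀_zero, Abelian.Ext.zero_comp]

/-- If `x` is `N`-regular and annihilates `M`, then `Ext^i(M, N/xN) = 0` forces
`Ext^{i+1}(M, N) = 0`. -/
theorem ExtVanishes.succ_of_quotSMulTop_right {x : A} (hx : x ∈ Module.annihilator A M)
    (hreg : IsSMulRegular N x) {i : ℕ} (h : ExtVanishes A M (QuotSMulTop x N) i) :
    ExtVanishes A M N (i + 1) := by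
  rw [extVanishes_iff]
  intro e
  have h0 : e.comp (Abelian.Ext.mk₀ (x • 𝟙 (ModuleCat.of A N))) (add_zero _) = 0 := by
    rw [← Abelian.Ext.smul_eq_comp_mk₀]
    exact ext_smul_eq_zero_of_mem_annihilator hx e
  have hS : ((ModuleCat.of A N).smulShortComplex x).ShortExact :=
    IsSMulRegular.smulShortComplex_shortExact (M := ModuleCat.of A N) hreg
  obtain ⟨y, hy⟩ := Abelian.Ext.covariant_sequence_exact₁ _ hS e h0 rfl
  rw [← hy, show y = 0 from Subsingleton.elim (h := h) _ _, Abelian.Ext.zero_comp]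
  rfl

theorem ExtVanishes.quotSMulTop_right {x : A} (hreg : IsSMulRegular N x) {i : ℕ}
    (h : ExtVanishes A M N i) (h' : ExtVanishes A M N (i + 1)) :
    ExtVanishes A M (QuotSMulTop x N) i :=
  h.covariant_right (f := LinearMap.lsmul A N x) hreg
    (LinearMap.exact_lsmul_mkQ_smul_top N x) (Submodule.mkQ_surjective _) h'

theorem ExtVanishes.quotSMulTop_left {x : A} (hreg : IsSMulRegular M x) {i : ℕ}
    (h : ExtVanishes A M N i) (h' : ExtVanishes A M N (i + 1)) :
    ExtVanishes A (QuotSMulTop x M) N (i + 1) :=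
  h.contravariant_right (f := LinearMap.lsmul A M x) hreg
    (LinearMap.exact_lsmul_mkQ_smul_top M x) (Submodule.mkQ_surjective _) h'

variable [IsLocalRing A]

theorem mem_annihilator_residueField_iff {x : A} :
    x ∈ Module.annihilator A (ResidueField A) ↔ x ∈ maximalIdeal A := by
  rw [show Module.annihilator A (ResidueField A) = maximalIdeal A from Ideal.annihilator_quotient]

instance isSimpleModule_residueField : IsSimpleModule A (ResidueField A) :=
  isSimpleModule_iff_quot_maximal.mpr
    ⟨maximalIdeal A, inferInstance, ⟨LinearEquiv.refl A (A ⧸ maximalIdeal A)⟩⟩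

variable [IsNoetherianRing A]

/-- A consequence of Nakayama's lemma for `Ext`. -/
theorem ExtVanishes.of_quotSMulTop_left [Module.Finite A M] [Module.Finite A N] {x : A}
    (hx : x ∈ maximalIdeal A) (hreg : IsSMulRegular M x) {i : ℕ}
    (h : ExtVanishes A (QuotSMulTop x M) N (i + 1)) : ExtVanishes A M N i := by
  have hS : ((ModuleCat.of A M).smulShortComplex x).ShortExact :=
    IsSMulRegular.smulShortComplex_shortExact (M := ModuleCat.of A M) hreg
  have hfin : Module.Finite A (Abelian.Ext (ModuleCat.of A M) (ModuleCat.of A N) i) :=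
    ModuleCat.finite_ext A (ModuleCat.of A M) (ModuleCat.of A N) i
  have : (⊤ : Submodule A (Abelian.Ext (ModuleCat.of A M) (ModuleCat.of A N) i)) = ⊥ := by
    refine Submodule.eq_bot_of_le_smul_of_le_jacobson_bot (maximalIdeal A) _ hfin.fg_top
      (fun y _ => ?_) (maximalIdeal_le_jacobson _)
    -- The long exact sequence makes multiplication by `x` surjective on this finite `Ext` module.
    obtain ⟨z, rfl⟩ := Abelian.Ext.contravariant_sequence_exact₁ hS _ y (add_comm 1 i)
      (Subsingleton.elim (h := h) _ _)
    have key (z : Abelian.Ext (ModuleCat.of A M) (ModuleCat.of A N) i) :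
        (Abelian.Ext.mk₀ (x • 𝟙 (ModuleCat.of A M))).comp z (zero_add i) = x • z := by
      rw [Abelian.Ext.mk₀_smul, Abelian.Ext.smul_comp, Abelian.Ext.mk₀_id_comp]
    exact (key z).symm ▸ Submodule.smul_mem_smul hx trivial
  exact (Submodule.subsingleton_iff A).mp (subsingleton_of_bot_eq_top this.symm)

theorem exists_isSMulRegular_of_extVanishes [Module.Finite A M]
    (h : ExtVanishes A (ResidueField A) M 0) :
    ∃ x ∈ maximalIdeal A, IsSMulRegular M x := by
  rw [extVanishes_zero_iff, IsSMulRegular.subsingleton_linearMap_iff] at h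
  simpa only [mem_annihilator_residueField_iff] using h

omit [IsNoetherianRing A] in
theorem exists_injective_of_not_extVanishes (h : ¬ ExtVanishes A (ResidueField A) M 0) :
    ∃ g : ResidueField A →ₗ[A] M, Function.Injective g := by
  rw [extVanishes_zero_iff, not_subsingleton_iff_nontrivial] at h
  obtain ⟨g, hg⟩ := exists_ne (0 : ResidueField A →ₗ[A] M)
  exact ⟨g, LinearMap.injective_of_ne_zero hg⟩

/-- The Rees characterization of depth. -/
theorem le_localDepth_iff [Module.Finite A M] {n : ℕ} :
    (n : ℕ∞) ≤ localDepth A M ↔ ∀ i < n, ExtVanishes A (ResidueField A) M i := by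
  have key : (n : ℕ∞) ≤ localDepth A M ↔ ∃ rs : List A, rs.length = n ∧
      (∀ r ∈ rs, r ∈ maximalIdeal A) ∧ RingTheory.Sequence.IsWeaklyRegular M rs := by
    constructor
    · intro h
      obtain ⟨rs, h1, h2, h3⟩ : ∃ rs : List A, (∀ r ∈ rs, r ∈ maximalIdeal A) ∧
          RingTheory.Sequence.IsWeaklyRegular M rs ∧ n ≤ rs.length := by
        by_contra! hcon
        rcases n with _ | n
        · exact absurd (hcon [] (by simp) (.nil A M)) (by simp)
        · refine absurd (h.trans (iSup_le fun rs => iSup_le fun h1 => iSup_le fun h2 => ?_ :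
            localDepth A M ≤ (n : ℕ∞))) ?_
          · exact_mod_cast Nat.lt_succ_iff.mp (hcon rs h1 h2)
          · exact_mod_cast Nat.not_succ_le_self n
      refine ⟨rs.take n, by simpa using h3, fun r hr => h1 r (List.mem_of_mem_take hr), ?_⟩
      rw [← List.take_append_drop n rs, RingTheory.Sequence.isWeaklyRegular_append_iff] at h2
      exact h2.1
    · rintro ⟨rs, rfl, h1, h2⟩
      exact le_iSup_of_le rs (le_iSup_of_le h1 (le_iSup_of_le h2 le_rfl))
  rw [key]
  -- The regular-sequence criterion needs `𝔪M ≠ M`. For `M = 0` a list of `n` zeros is weakly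
  -- regular, in line with `depth 0 = ∞`.
  rcases subsingleton_or_nontrivial M with hM | hM
  · refine iff_of_true ⟨List.replicate n 0, by simp, ?_, ?_⟩
      fun i _ => extVanishes_of_subsingleton_right i
    · intro r hr
      rw [List.eq_of_mem_replicate hr]
      exact zero_mem _
    · exact ⟨fun i h => fun _ _ _ => Subsingleton.elim _ _⟩
  · have hlt : maximalIdeal A • (⊤ : Submodule A M) < ⊤ :=
      lt_top_iff_ne_top.mpr (Submodule.top_ne_ideal_smul_of_le_jacobson_annihilator
        (maximalIdeal_le_jacobson _)).symm
    have hsupp : Module.support A (ResidueField A) =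
        PrimeSpectrum.zeroLocus (maximalIdeal A : Set A) := by
      rw [Module.support_eq_zeroLocus]
      congr 2
      ext x
      exact mem_annihilator_residueField_iff
    constructor
    · rintro ⟨rs, rfl, h1, h2⟩
      exact ModuleCat.subsingleton_ext_of_exists_isRegular (maximalIdeal A)
        (ModuleCat.of A (ResidueField A)) hsupp.subset (ModuleCat.of A M) hlt rs h1
        ((isRegular_iff_isWeaklyRegular_of_subset_maximalIdeal h1).mpr h2)
    · intro h
      obtain ⟨rs, h1, h2, h3⟩ := ModuleCat.exists_isRegular_of_exists_subsingleton_ext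
        (maximalIdeal A) n (ModuleCat.of A M) hlt (ModuleCat.of A (ResidueField A)) hsupp h
      exact ⟨rs, h1, h2, h3.toIsWeaklyRegular⟩

/-- A depth-`t` module `M` whose higher `Ext` into `N` vanish from degree `j` on transports
vanishing to the residue field in degree `j + t`. -/
theorem ExtVanishes.residueField_of_depth [Module.Finite A N] (t : ℕ) {j : ℕ}
    [Module.Finite A M] (hM : ∀ i, j ≤ i → ExtVanishes A M N i)
    (hlt : ∀ i < t, ExtVanishes A (ResidueField A) M i)
    (ht : ¬ ExtVanishes A (ResidueField A) M t)
    (htop : ∀ (X : Type u) [AddCommGroup X] [Module A X], Module.Finite A X →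
      ExtVanishes A X N (j + t + 1)) :
    ExtVanishes A (ResidueField A) N (j + t) := by
  induction t generalizing M j with
  | zero =>
    obtain ⟨g, hg⟩ := exists_injective_of_not_extVanishes ht
    exact (hM j le_rfl).contravariant_left hg (LinearMap.exact_map_mkQ_range g)
      (Submodule.mkQ_surjective _) (htop _ inferInstance)
  | succ t ih =>
    -- Passing to `M/xM` lowers the depth by one and delays the vanishing into `N` by one degree, so
    -- `j + t` is unchanged.
    obtain ⟨x, hx, hreg⟩ := exists_isSMulRegular_of_extVanishes (hlt 0 t.succ_pos)
    rw [← add_assoc, add_right_comm]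
    refine ih (M := QuotSMulTop x M) (j := j + 1) (fun i hi => ?_) (fun i hi => ?_) (fun h => ?_)
      (fun X _ _ hX => ?_)
    · obtain ⟨i, rfl⟩ := Nat.exists_eq_add_of_le' hi
      rw [← add_assoc]
      exact (hM _ (by omega)).quotSMulTop_left hreg (hM _ (by omega))
    · exact (hlt i (by omega)).quotSMulTop_right hreg (hlt (i + 1) (by omega))
    · exact ht (h.succ_of_quotSMulTop_right (mem_annihilator_residueField_iff.mpr hx) hreg)
    · have := htop X hX
      rwa [show j + 1 + t + 1 = j + (t + 1) + 1 by omega]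

/-- Vanishing of `Ext` from the residue field propagates to all finite modules if the next
degree vanishes on all finite modules. -/
theorem ExtVanishes.of_residueField [Module.Finite A N] {j : ℕ}
    (hk : ExtVanishes A (ResidueField A) N j)
    (htop : ∀ (X : Type u) [AddCommGroup X] [Module A X], Module.Finite A X →
      ExtVanishes A X N (j + 1)) (X : Type u) [AddCommGroup X] [Module A X]
    (hX : Module.Finite A X) : ExtVanishes A X N j := by
  induction hX using IsNoetherianRing.induction_on_isQuotientEquivQuotientPrime A with
  | subsingleton X =>
    exact hk.of_sum_eq_id_left (ι := Empty) (fun e => e.elim) (fun e => e.elim)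
      (LinearMap.ext fun _ => Subsingleton.elim _ _)
  | quotient X p e =>
    refine ExtVanishes.congr_left e.symm ?_
    -- A finite module is filtered by quotients `A/𝔭`. If `𝔭 ≠ 𝔪`, any `x ∈ 𝔪 \ 𝔭` is regular on
    -- `A/𝔭`, and Nakayama brings the vanishing down from degree `j + 1`.
    by_cases hp : p.asIdeal = maximalIdeal A
    · rw [hp]; exact hk
    · obtain ⟨x, hx, hxp⟩ := SetLike.exists_of_lt
        (lt_of_le_of_ne (le_maximalIdeal p.isPrime.ne_top) hp)
      refine ExtVanishes.of_quotSMulTop_left hx ?_ (htop _ inferInstance)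
      rw [isSMulRegular_iff_right_eq_zero_of_smul]
      intro y hy
      obtain ⟨y, rfl⟩ := Ideal.Quotient.mk_surjective y
      rw [Algebra.smul_def, Ideal.Quotient.algebraMap_eq, ← map_mul,
        Ideal.Quotient.eq_zero_iff_mem] at hy
      exact Ideal.Quotient.eq_zero_iff_mem.mpr ((p.isPrime.mem_or_mem hy).resolve_left hxp)
  | exact X Y Z f g hf hg hfg hX hZ => exact hZ.contravariant_middle hf hfg hg hX

/-- Each regular element gains one degree: the vanishing for `M/xM` in degree `j + 1` descends to
`M` in degree `j` by Nakayama. -/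
theorem ExtVanishes.of_depth [Module.Finite A N] (t : ℕ) {j : ℕ} [Module.Finite A M]
    (hlt : ∀ i < t, ExtVanishes A (ResidueField A) M i)
    (htop : ∀ (X : Type u) [AddCommGroup X] [Module A X], Module.Finite A X →
      ExtVanishes A X N (j + t)) : ExtVanishes A M N j := by
  induction t generalizing M j with
  | zero => exact htop M inferInstance
  | succ t ih =>
    obtain ⟨x, hx, hreg⟩ := exists_isSMulRegular_of_extVanishes (hlt 0 t.succ_pos)
    refine ExtVanishes.of_quotSMulTop_left hx hreg (ih (fun i hi => ?_) (fun X _ _ hX => ?_))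
    · exact (hlt i (by omega)).quotSMulTop_right hreg (hlt (i + 1) (by omega))
    · have := htop X hX
      rwa [show j + 1 + t = j + (t + 1) by omega]

/-- Over a local ring of depth `d`, a finite module of finite injective dimension has injective
dimension at most `d` on finite modules. -/
theorem HasFiniteInjDim.extVanishes [Module.Finite A N] (hN : HasFiniteInjDim A N) {d : ℕ}
    (hd : localDepth A A = d) {j : ℕ} (hj : 0 < j) (X : Type u) [AddCommGroup X] [Module A X]
    (hX : Module.Finite A X) : ExtVanishes A X N (j + d) := by
  obtain ⟨m, hm⟩ := hN
  have hlt : ∀ i < d, ExtVanishes A (ResidueField A) A i := le_localDepth_iff.mp hd.ge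
  have ht : ¬ ExtVanishes A (ResidueField A) A d := fun h => by
    have : ((d + 1 : ℕ) : ℕ∞) ≤ localDepth A A := le_localDepth_iff.mpr fun i hi => by
      rcases Nat.lt_succ_iff_lt_or_eq.mp hi with h1 | rfl
      exacts [hlt i h1, h]
    rw [hd] at this
    exact absurd this (by exact_mod_cast Nat.not_succ_le_self d)
  -- Descending induction on the degree, from `m + 1` down to `d + 1`. The ring itself serves as the
  -- test module of depth exactly `d`; `0 < j` is what makes `Ext^j(A, N)` vanish.
  have key : ∀ e j : ℕ, 0 < j → m + 1 ≤ j + d + e → ∀ (X : Type u) [AddCommGroup X] [Module A X],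
      Module.Finite A X → ExtVanishes A X N (j + d) := by
    intro e
    induction e with
    | zero =>
      intro j _ hj X _ _ _
      exact HasInjectiveDimensionLT.subsingleton (ModuleCat.of A N) (m + 1) _ hj _
    | succ e ih =>
      intro j h0 hj
      have htop : ∀ (X : Type u) [AddCommGroup X] [Module A X], Module.Finite A X →
          ExtVanishes A X N (j + d + 1) := fun X _ _ hX => by
        have := ih (j + 1) (by omega) (by omega) X hX
        rwa [add_right_comm]
      exact ExtVanishes.of_residueField (ExtVanishes.residueField_of_depth (M := A) d
        (fun i hi => extVanishes_of_projective (by omega)) hlt ht htop) htop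
  exact key (m + 1) j hj (by omega) X hX

/-- Otherwise `Ext^d(-, N)` would vanish on all finite modules, and `d` regular elements of `A`
would bring this down to `Hom(A, N) = N = 0`. -/
theorem HasFiniteInjDim.not_extVanishes [Module.Finite A N] [Nontrivial N]
    (hN : HasFiniteInjDim A N) {d : ℕ} (hd : localDepth A A = d) :
    ¬ ExtVanishes A (ResidueField A) N d := by
  intro h
  have h1 := ExtVanishes.of_residueField h fun X _ _ hX => by
    rw [add_comm]; exact hN.extVanishes hd one_pos X hX
  have h2 : ExtVanishes A A N 0 := ExtVanishes.of_depth d (le_localDepth_iff.mp hd.ge)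
    fun X _ _ hX => by rw [zero_add]; exact h1 X hX
  rw [extVanishes_zero_iff] at h2
  have := (LinearMap.ringLmapEquivSelf A A N).symm.toEquiv.subsingleton
  exact not_subsingleton N this

/-- Over a local ring of depth `d`, if `N ≠ 0` has finite injective dimension, `M` has depth at
least `d - 1` and `Ext^i(M, N) = 0` for all `i > 0`, then `M` has depth at least `d`. -/
theorem HasFiniteInjDim.depth_of_extVanishes [Module.Finite A N] [Nontrivial N]
    (hN : HasFiniteInjDim A N) {d : ℕ} (hd : localDepth A A = d) [Module.Finite A M]
    (hM : ∀ i, 1 ≤ i → ExtVanishes A M N i)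
    (hdepth : ∀ i, i + 1 < d → ExtVanishes A (ResidueField A) M i) {i : ℕ} (hi : i < d) :
    ExtVanishes A (ResidueField A) M i := by
  obtain ⟨d, rfl⟩ := Nat.exists_eq_succ_of_ne_zero (by omega : d ≠ 0)
  rcases Nat.lt_succ_iff_lt_or_eq.mp hi with h1 | rfl
  · exact hdepth i (by omega)
  -- Failure means that `M` has depth exactly `d - 1`; shifting from degree `1` then kills `Ext^d(k,
  -- N)`.
  by_contra hcon
  refine hN.not_extVanishes hd ?_
  rw [Nat.succ_eq_add_one, add_comm]
  refine ExtVanishes.residueField_of_depth (M := M) i hM (fun j hj => hdepth j (by omega)) hcon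
    fun X _ _ hX => ?_
  rw [add_comm 1 i, add_comm (i + 1) 1]
  exact hN.extVanishes hd one_pos X hX

end LocalRing

/-! ### Regular sequences on a semidualizing module. -/

section Semidualizing

open scoped Pointwise

variable {A : Type u} [CommRing A]

/-- If `Ext¹(M, X) = 0`, every map `M → Z` lifts along `Y ↠ Z` with kernel `X`. -/
theorem ExtVanishes.exists_lift {X Y Z M : Type u} [AddCommGroup X] [Module A X] [AddCommGroup Y]
    [Module A Y] [AddCommGroup Z] [Module A Z] [AddCommGroup M] [Module A M]
    {f : X →ₗ[A] Y} {g : Y →ₗ[A] Z} (hf : Function.Injective f)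
    (hfg : Function.Exact f g) (hg : Function.Surjective g) (h : ExtVanishes A M X 1)
    (φ : M →ₗ[A] Z) : ∃ ψ : M →ₗ[A] Y, g ∘ₗ ψ = φ := by
  obtain ⟨y, hy⟩ := Abelian.Ext.covariant_sequence_exact₃ (ModuleCat.of A M)
    (shortExact_of_linearMap hf hfg hg) (Abelian.Ext.mk₀ (ModuleCat.ofHom φ)) (zero_add 1)
    (extVanishes_iff.mp h _)
  obtain ⟨ψ, rfl⟩ := (Abelian.Ext.mk₀_bijective _ _).2 y
  rw [Abelian.Ext.mk₀_comp_mk₀] at hy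
  have := (Abelian.Ext.mk₀_bijective _ _).1 hy
  exact ⟨ψ.hom, congrArg ModuleCat.Hom.hom this⟩

variable {C N : Type u} [AddCommGroup C] [Module A C] [AddCommGroup N] [Module A N]

/-- Maps from `C` to `K = ker(x : N → N)` are killed by `x`, so `Hom(C, K) = 0`. Hence some element
of the annihilator of `C` is `K`-regular; that element is `0`, so `K = 0`. -/
theorem isSMulRegular_of_linearMap [IsNoetherianRing A] [Module.Finite A C]
    (hC : Module.annihilator A C = ⊥) [Module.Finite A N] {x : A}
    (hx : IsSMulRegular (C →ₗ[A] N) x) : IsSMulRegular N x := by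
  have hK : Subsingleton (C →ₗ[A] LinearMap.ker (LinearMap.lsmul A N x)) := by
    refine subsingleton_of_forall_eq 0 fun φ => ?_
    have h : (LinearMap.ker (LinearMap.lsmul A N x)).subtype ∘ₗ φ = 0 := by
      refine hx ?_
      ext c
      exact (LinearMap.mem_ker.mp (φ c).2).trans (smul_zero x).symm
    ext c
    simpa using LinearMap.congr_fun h c
  rw [IsSMulRegular.subsingleton_linearMap_iff] at hK
  obtain ⟨r, hr, hreg⟩ := hK
  rw [hC, Ideal.mem_bot] at hr
  subst hr
  rw [isSMulRegular_iff_right_eq_zero_of_smul]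
  intro y hy
  have : (⟨y, hy⟩ : LinearMap.ker (LinearMap.lsmul A N x)) = 0 := hreg (by simp)
  exact congrArg Subtype.val this

/-- If `x` is `N`-regular and `Ext¹(C, N) = 0` then `Hom(C, N/xN) = Hom(C, N)/x Hom(C, N)`. -/
theorem nonempty_quotSMulTop_linearMap_equiv {x : A} (hx : IsSMulRegular N x)
    (h : ExtVanishes A C N 1) :
    Nonempty (QuotSMulTop x (C →ₗ[A] N) ≃ₗ[A] (C →ₗ[A] QuotSMulTop x N)) := by
  let q : N →ₗ[A] QuotSMulTop x N := Submodule.mkQ _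
  let F : (C →ₗ[A] N) →ₗ[A] (C →ₗ[A] QuotSMulTop x N) := LinearMap.compRight A q
  have hF : Function.Surjective F := fun φ =>
    h.exists_lift (f := LinearMap.lsmul A N x) hx (LinearMap.exact_lsmul_mkQ_smul_top N x)
      (Submodule.mkQ_surjective _) φ
  have hker : x • (⊤ : Submodule A (C →ₗ[A] N)) = LinearMap.ker F := by
    ext φ
    rw [Submodule.mem_smul_pointwise_iff_exists, LinearMap.mem_ker]
    constructor
    · rintro ⟨ψ, -, rfl⟩
      ext c
      exact (Submodule.Quotient.mk_eq_zero _).mpr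
        (Submodule.smul_mem_pointwise_smul (ψ c) x ⊤ trivial)
    · intro h0
      have hmem (c : C) : φ c ∈ LinearMap.range (LinearMap.lsmul A N x) :=
        (LinearMap.exact_lsmul_mkQ_smul_top N x (φ c)).mp (LinearMap.congr_fun h0 c)
      let e := LinearEquiv.ofInjective (LinearMap.lsmul A N x) hx
      refine ⟨e.symm.toLinearMap ∘ₗ φ.codRestrict _ hmem, trivial, ?_⟩
      ext c
      exact congrArg Subtype.val (e.apply_symm_apply ⟨φ c, hmem c⟩)
  exact ⟨(Submodule.quotEquivOfEq _ _ hker).trans (F.quotKerEquivOfSurjective hF)⟩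

theorem isWeaklyRegular_of_linearMap [IsNoetherianRing A] [Module.Finite A C]
    (hC : Module.annihilator A C = ⊥) [Module.Finite A N]
    (hN : ∀ i, 0 < i → ExtVanishes A C N i) {rs : List A}
    (h : RingTheory.Sequence.IsWeaklyRegular (C →ₗ[A] N) rs) :
    RingTheory.Sequence.IsWeaklyRegular N rs := by
  induction rs generalizing N with
  | nil => exact .nil A N
  | cons x rs ih =>
    rw [RingTheory.Sequence.isWeaklyRegular_cons_iff] at h ⊢
    have hx := isSMulRegular_of_linearMap hC h.1
    obtain ⟨e⟩ := nonempty_quotSMulTop_linearMap_equiv hx (hN 1 one_pos)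
    exact ⟨hx, ih (fun i hi => (hN i hi).quotSMulTop_right hx (hN _ i.succ_pos))
      ((e.isWeaklyRegular_congr rs).mp h.2)⟩

theorem IsSemidualizing.annihilator_eq_bot (hC : IsSemidualizing A C) :
    Module.annihilator A C = ⊥ := by
  refine (Submodule.eq_bot_iff _).mpr fun r hr => hC.homothety.1 ?_
  ext c
  simpa using Module.mem_annihilator.mp hr c

/-- The homothety identifies `A` with `Hom(C, C)`, from which regularity passes to `C`. -/
theorem IsSemidualizing.isWeaklyRegular [IsNoetherianRing A] (hC : IsSemidualizing A C)
    {rs : List A} (h : RingTheory.Sequence.IsWeaklyRegular A rs) :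
    RingTheory.Sequence.IsWeaklyRegular C rs :=
  have := hC.finite
  isWeaklyRegular_of_linearMap hC.annihilator_eq_bot hC.ext_vanishing
    (((LinearEquiv.ofBijective _ hC.homothety).isWeaklyRegular_congr rs).mp h)

theorem IsSemidualizing.localDepth_le [IsNoetherianRing A] [IsLocalRing A]
    (hC : IsSemidualizing A C) : localDepth A A ≤ localDepth A C :=
  iSup_mono fun _ => iSup_mono fun _ => iSup_mono' fun h => ⟨hC.isWeaklyRegular h, le_rfl⟩

theorem isSemidualizing_self : IsSemidualizing A A where
  finite := inferInstance
  homothety := by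
    refine ⟨fun a b h => ?_, fun f => ⟨f 1, ?_⟩⟩
    · simpa using LinearMap.congr_fun h 1
    · ext
      simp
  ext_vanishing i hi := extVanishes_of_projective hi

end Semidualizing

/-! ### Localization of `Ext` vanishing and of semidualizing modules. -/

section Localization

variable {R : Type u} [CommRing R] (S : Submonoid R)

theorem localizedModule_map_exact {X Y Z : Type*} [AddCommGroup X] [Module R X] [AddCommGroup Y]
    [Module R Y] [AddCommGroup Z] [Module R Z] {f : X →ₗ[R] Y} {g : Y →ₗ[R] Z}
    (h : Function.Exact f g) :
    Function.Exact (LocalizedModule.map S f) (LocalizedModule.map S g) :=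
  LocalizedModule.map_exact S f g h

theorem localizedModule_map_comp {X Y Z : Type*} [AddCommGroup X] [Module R X] [AddCommGroup Y]
    [Module R Y] [AddCommGroup Z] [Module R Z] (f : X →ₗ[R] Y) (g : Y →ₗ[R] Z) :
    LocalizedModule.map S (g ∘ₗ f) = LocalizedModule.map S g ∘ₗ LocalizedModule.map S f := by
  ext x
  induction x using LocalizedModule.induction_on with
  | h m s => simp

theorem localizedModule_exists_smul_eq_map [IsNoetherianRing R] {X Y : Type*} [AddCommGroup X]
    [Module R X] [AddCommGroup Y] [Module R Y] [Module.Finite R X]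
    (φ : LocalizedModule S X →ₗ[Localization S] LocalizedModule S Y) :
    ∃ (s : S) (ψ : X →ₗ[R] Y), LocalizedModule.map S ψ = s • φ := by
  have := Module.finitePresentation_of_finite R X
  obtain ⟨⟨ψ, s⟩, h⟩ := IsLocalizedModule.surj S (LocalizedModule.map S (M := X) (N := Y)) φ
  exact ⟨s, ψ, h.symm⟩

/-- A free cover of `M` shifts degrees down to `Ext¹`, whose vanishing is an extension property for
maps out of the kernel. Such maps localize up to a denominator because the kernel is finitely
presented. -/
theorem ExtVanishes.localizedModule [IsNoetherianRing R] {M N : Type u} [AddCommGroup M]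
    [Module R M] [AddCommGroup N] [Module R N] [Module.Finite R M] {i : ℕ} (hi : 0 < i)
    (h : ExtVanishes R M N i) :
    ExtVanishes (Localization S) (LocalizedModule S M) (LocalizedModule S N) i := by
  obtain ⟨i, rfl⟩ := Nat.exists_eq_add_of_le' hi
  induction i generalizing M with
  | zero =>
    obtain ⟨n, g, hg⟩ := Module.Finite.exists_fin' R M
    let f := (LinearMap.ker g).subtype
    have hf : Function.Injective f := Subtype.val_injective
    have hfg : Function.Exact f g := LinearMap.exact_subtype_ker_map g
    refine ExtVanishes.one_of_forall_extension (LocalizedModule.map_injective S f hf)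
      (localizedModule_map_exact S hfg) (LocalizedModule.map_surjective S g hg)
      (extVanishes_of_projective one_pos) fun φ => ?_
    obtain ⟨s, φ₀, hφ⟩ := localizedModule_exists_smul_eq_map S φ
    obtain ⟨ψ₀, hψ⟩ := h.exists_extension hf hfg hg φ₀
    refine ⟨Localization.mk 1 s • LocalizedModule.map S ψ₀, ?_⟩
    rw [LinearMap.smul_comp, ← localizedModule_map_comp, hψ, hφ, Submonoid.smul_def,
      ← IsScalarTower.algebraMap_smul (Localization S) (s : R) φ, smul_smul,
      ← Localization.mk_one_eq_algebraMap, Localization.mk_mul,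
      one_mul, mul_one, Localization.mk_self, one_smul]
  | succ i ih =>
    obtain ⟨n, g, hg⟩ := Module.Finite.exists_fin' R M
    let f := (LinearMap.ker g).subtype
    have hf : Function.Injective f := Subtype.val_injective
    have hfg : Function.Exact f g := LinearMap.exact_subtype_ker_map g
    exact (ih (M := LinearMap.ker g) i.succ_pos ((extVanishes_of_projective
      i.succ_pos).contravariant_left hf hfg hg h)).contravariant_right
      (LocalizedModule.map_injective S f hf)
      (localizedModule_map_exact S hfg) (LocalizedModule.map_surjective S g hg)
      (extVanishes_of_projective (Nat.succ_pos _))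

/-- As `C` is finitely presented, `Hom(C, C) ≃ R` localizes to the endomorphisms of the localized
module. Both ends of the localized homothety are thus localizations of `R`, and it is the canonical
isomorphism between them. -/
theorem IsSemidualizing.localizedModule [IsNoetherianRing R] {C : Type u} [AddCommGroup C]
    [Module R C] (hC : IsSemidualizing R C) :
    IsSemidualizing (Localization S) (LocalizedModule S C) where
  finite := have := hC.finite; inferInstance
  homothety := by
    have := hC.finite
    have := Module.finitePresentation_of_finite R C
    let e : R ≃ₗ[R] C →ₗ[R] C := LinearEquiv.ofBijective _ hC.homothety
    let L : Localization S →ₗ[R]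
        (LocalizedModule S C →ₗ[Localization S] LocalizedModule S C) :=
      (LinearMap.lsmul (Localization S) (LocalizedModule S C)).restrictScalars R
    have hL : L ∘ₗ Algebra.linearMap R (Localization S) =
        LocalizedModule.map S (M := C) (N := C) ∘ₗ e.toLinearMap := by
      ext x
      induction x using LocalizedModule.induction_on with
      | h m s => simp [L, e]
    have : IsLocalizedModule S (L ∘ₗ Algebra.linearMap R (Localization S)) := by
      rw [hL]
      infer_instance
    have key := IsLocalizedModule.linearEquiv_of_isLocalizedModule_comp S
      (Algebra.linearMap R (Localization S)) L
    have : Function.Bijective L := by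
      rw [← key]
      exact (IsLocalizedModule.linearEquiv ..).bijective
    exact this
  ext_vanishing i hi := have := hC.finite; ExtVanishes.localizedModule S hi (hC.ext_vanishing i hi)

end Localization

/-! ### Splicing and cutting `C`-coresolutions, and left approximations by `C`. -/

section Syzygy

variable {R : Type u} [CommRing R] {C : Type u} [AddCommGroup C] [Module R C]

/-- Prepend a module to a sequence of modules. -/
def consModule (N : ModuleCat.{u} R) (P : ℕ → ModuleCat.{u} R) : ℕ → ModuleCat.{u} R
  | 0 => N
  | i + 1 => P i

/-- Prepend a map to a sequence of maps. -/
def consMap {N : ModuleCat.{u} R} {P : ℕ → ModuleCat.{u} R} (f : N →ₗ[R] P 0)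
    (d : ∀ i, P i →ₗ[R] P (i + 1)) : ∀ i, consModule N P i →ₗ[R] consModule N P (i + 1)
  | 0 => f
  | i + 1 => d i

theorem isCSyzygy_zero (M : Type u) [AddCommGroup M] [Module R M] : IsCSyzygy R C 0 M :=
  ⟨fun _ => ModuleCat.of R M, fun _ => 0, ⟨LinearEquiv.refl R M⟩, by omega, by omega, by omega⟩

theorem isCSyzygy_succ_of_exact {n : ℕ} {M : Type u} [AddCommGroup M] [Module R M]
    {P N : Type u} [AddCommGroup P] [Module R P] [AddCommGroup N] [Module R N]
    {f : M →ₗ[R] P} {g : P →ₗ[R] N} (hf : Function.Injective f) (hfg : Function.Exact f g)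
    (hg : Function.Surjective g) (hP : IsSummandOfCopies R C P) (hN : IsCSyzygy R C n N) :
    IsCSyzygy R C (n + 1) M := by
  obtain ⟨Q, d, ⟨e⟩, h1, h2, h3⟩ := hN
  refine ⟨consModule (ModuleCat.of R M) (consModule (ModuleCat.of R P) fun i => Q (i + 1)),
    consMap f (consMap (d 0 ∘ₗ e.toLinearMap ∘ₗ g) fun i => d (i + 1)),
    ⟨LinearEquiv.refl R M⟩, ?_, fun _ => hf, ?_⟩
  · rintro (_ | _ | i) hi hin
    · omega
    · exact hP
    · exact h1 (i + 1) (by omega) (by omega)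
  · rintro (_ | _ | i) hi
    · intro x
      refine Iff.trans ?_ (hfg x)
      -- Exactness is asked here only when `n ≥ 1`, which makes `d 0` injective.
      have hinj : Function.Injective (d 0 ∘ₗ e.toLinearMap) := by
        simpa using h2 (by omega)
      exact map_eq_zero_iff (d 0 ∘ₗ e.toLinearMap) hinj
    · intro x
      refine (h3 0 (by omega) x).trans ⟨?_, ?_⟩
      · rintro ⟨y, rfl⟩
        obtain ⟨z, hz⟩ := hg (e.symm y)
        exact ⟨z, congrArg (d 0) ((congrArg e hz).trans (e.apply_symm_apply y))⟩
      · rintro ⟨y, rfl⟩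
        exact ⟨e (g y), rfl⟩
    · exact h3 (i + 1) (by omega)

theorem IsCSyzygy.exists_exact {n : ℕ} {M : Type u} [AddCommGroup M] [Module R M]
    (h : IsCSyzygy R C (n + 1) M) :
    ∃ (P N : ModuleCat.{u} R) (f : M →ₗ[R] P) (g : P →ₗ[R] N), Function.Injective f ∧
      Function.Exact f g ∧ Function.Surjective g ∧ IsSummandOfCopies R C P ∧
      IsCSyzygy R C n N := by
  obtain ⟨P, d, ⟨e⟩, h1, h2, h3⟩ := h
  refine ⟨P 1, ModuleCat.of R (P 1 ⧸ LinearMap.range (d 0)), d 0 ∘ₗ e.toLinearMap,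
    (LinearMap.range (d 0)).mkQ, ?_, ?_, Submodule.mkQ_surjective _, h1 1 le_rfl (by omega), ?_⟩
  · simpa using h2 (by omega)
  · intro x
    refine ((d 0).exact_map_mkQ_range x).trans ⟨?_, ?_⟩
    · rintro ⟨y, rfl⟩
      exact ⟨e.symm y, by simp⟩
    · rintro ⟨y, rfl⟩
      exact ⟨e y, rfl⟩
  -- For `n = 0` nothing embeds the cokernel further, and nothing is required of it.
  · rcases n with _ | n
    · exact isCSyzygy_zero _
    have h01 := h3 0 (by omega)
    let f : (P 1 ⧸ LinearMap.range (d 0)) →ₗ[R] P 2 :=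
      (LinearMap.range (d 0)).liftQ (d 1)
        (LinearMap.range_le_ker_iff.mpr h01.linearMap_comp_eq_zero)
    refine ⟨consModule (ModuleCat.of R (P 1 ⧸ LinearMap.range (d 0))) fun i => P (i + 2),
      consMap f fun i => d (i + 2), ⟨LinearEquiv.refl R _⟩, ?_, fun _ => ?_, ?_⟩
    · rintro (_ | i) hi hin
      · omega
      · exact h1 (i + 2) (by omega) (by omega)
    · exact LinearMap.ker_eq_bot.mp (Submodule.ker_liftQ_eq_bot' _ _
        (LinearMap.exact_iff.mp h01).symm)
    · rintro (_ | i) hi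
      · intro x
        refine (h3 1 (by omega) x).trans ⟨?_, ?_⟩
        · rintro ⟨y, rfl⟩
          exact ⟨Submodule.Quotient.mk y, rfl⟩
        · rintro ⟨y, rfl⟩
          obtain ⟨y, rfl⟩ := Submodule.Quotient.mk_surjective _ y
          exact ⟨y, rfl⟩
      · exact h3 (i + 2) (by omega)

theorem IsSummandOfCopies.finite [Module.Finite R C] {P : Type u} [AddCommGroup P] [Module R P]
    (h : IsSummandOfCopies R C P) : Module.Finite R P := by
  obtain ⟨k, i, r, h⟩ := h
  exact Module.Finite.of_surjective r fun x => ⟨i x, LinearMap.congr_fun h x⟩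

theorem IsSummandOfCopies.localizedModule (S : Submonoid R) {P : Type u} [AddCommGroup P]
    [Module R P] (h : IsSummandOfCopies R C P) :
    ∃ (k : ℕ) (s : Fin k → LocalizedModule S P →ₗ[Localization S] LocalizedModule S C)
      (r : Fin k → LocalizedModule S C →ₗ[Localization S] LocalizedModule S P),
      ∑ j, r j ∘ₗ s j = LinearMap.id := by
  obtain ⟨k, s, r, h⟩ := h.exists_sum_eq_id
  refine ⟨k, fun j => LocalizedModule.map S (s j), fun j => LocalizedModule.map S (r j), ?_⟩
  simp only [← localizedModule_map_comp]
  rw [← map_sum, h, LocalizedModule.map_id]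

/-- Every homomorphism from `M` to `C` factors through a single map from `M` to a finite direct
sum of copies of `C`. -/
theorem exists_left_approximation [IsNoetherianRing R] (C : Type u) [AddCommGroup C] [Module R C]
    [Module.Finite R C] (M : Type u) [AddCommGroup M] [Module R M] [Module.Finite R M] :
    ∃ (k : ℕ) (f : M →ₗ[R] (Fin k → C)), ∀ φ : M →ₗ[R] C, ∃ ψ : (Fin k → C) →ₗ[R] C,
      ψ ∘ₗ f = φ := by
  obtain ⟨k, s, hs⟩ := Module.Finite.exists_fin (R := R) (M := M →ₗ[R] C)
  refine ⟨k, LinearMap.pi s, fun φ => ?_⟩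
  obtain ⟨c, rfl⟩ := (Submodule.mem_span_range_iff_exists_fun R).mp
    (hs ▸ Submodule.mem_top : φ ∈ Submodule.span R (Set.range s))
  refine ⟨∑ j, c j • LinearMap.proj j, ?_⟩
  ext x
  simp

end Syzygy

/-! ### Exchanging summands through the local endomorphism ring of `C`. -/

section Retract

open IsLocalRing

variable {A : Type u} [CommRing A]

theorem HasFiniteInjDim.of_retract {C W : Type u} [AddCommGroup C] [Module A C] [AddCommGroup W]
    [Module A W] (hW : HasFiniteInjDim A W) (i : C →ₗ[A] W) (r : W →ₗ[A] C)
    (h : r ∘ₗ i = LinearMap.id) : HasFiniteInjDim A C := by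
  obtain ⟨m, hm⟩ := hW
  let ρ : Retract (ModuleCat.of A C) (ModuleCat.of A W) :=
    ⟨ModuleCat.ofHom i, ModuleCat.ofHom r, ModuleCat.hom_ext h⟩
  exact ⟨m, ρ.hasInjectiveDimensionLT (m + 1)⟩

/-- Over a local ring, if `W ≠ 0` is a direct summand of a finite direct sum of copies of a module
`C` all of whose endomorphisms are homotheties, then `C` is a direct summand of `W`. -/
theorem exists_retract_of_sum_eq_id [IsLocalRing A] {C W : Type u} [AddCommGroup C]
    [Module A C] (hC : Function.Surjective (LinearMap.lsmul A C)) [AddCommGroup W] [Module A W]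
    [Nontrivial W] {k : ℕ} (s : Fin k → W →ₗ[A] C) (r : Fin k → C →ₗ[A] W)
    (h : ∑ j, r j ∘ₗ s j = LinearMap.id) :
    ∃ (i : C →ₗ[A] W) (q : W →ₗ[A] C), q ∘ₗ i = LinearMap.id := by
  choose a ha using fun l j => hC (s l ∘ₗ r j)
  -- A unit homothety `s l ∘ r j` splits `C` off `W`. Without one, the span of the `s l` lies in `𝔪`
  -- times itself, so Nakayama gives `s = 0` and then `W = 0`.
  by_cases hu : ∃ l j, IsUnit (a l j)
  · obtain ⟨l, j, u, hu⟩ := hu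
    refine ⟨((u⁻¹ : Aˣ) : A) • r j, s l, ?_⟩
    rw [LinearMap.comp_smul, ← ha, ← hu]
    ext c
    simp [smul_smul]
  · push Not at hu
    exfalso
    have hI : Submodule.span A (Set.range s) = ⊥ := by
      refine Submodule.eq_bot_of_le_smul_of_le_jacobson_bot (maximalIdeal A) _
        (Submodule.fg_span (Set.finite_range s)) ?_ (maximalIdeal_le_jacobson _)
      rw [Submodule.span_le]
      rintro _ ⟨l, rfl⟩
      have : s l = ∑ j, a l j • s j := by
        ext w
        have := congrArg (s l) (LinearMap.congr_fun h w)
        simp only [LinearMap.sum_apply, map_sum, LinearMap.comp_apply, LinearMap.id_apply] at this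
        rw [← this, LinearMap.sum_apply]
        exact Finset.sum_congr rfl fun j _ => (LinearMap.congr_fun (ha l j) (s j w)).symm
      rw [this]
      exact Submodule.sum_mem _ fun j _ => Submodule.smul_mem_smul
        ((mem_maximalIdeal _).mpr (hu l j)) (Submodule.subset_span ⟨j, rfl⟩)
    have hs (j : Fin k) : s j = 0 :=
      (Submodule.mem_bot A).mp (hI ▸ Submodule.subset_span ⟨j, rfl⟩)
    obtain ⟨w, hw⟩ := exists_ne (0 : W)
    refine hw ?_
    rw [← LinearMap.id_apply (R := A) w, ← h]
    simp [hs]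

end Retract

/-! ### Serre's condition and the equivalences over a Cohen–Macaulay ring. -/

section CohenMacaulay

open IsLocalRing

variable {R : Type u} [CommRing R] [IsNoetherianRing R]

theorem satisfiesSerre_iff {n : ℕ} {M : Type u} [AddCommGroup M] [Module R M] [Module.Finite R M] :
    SatisfiesSerre R n M ↔ ∀ p : PrimeSpectrum R, ∀ i : ℕ, i < n → (i : ℕ∞) < p.asIdeal.height →
      ExtVanishes (Localization.AtPrime p.asIdeal) (ResidueField (Localization.AtPrime p.asIdeal))
        (LocalizedModule p.asIdeal.primeCompl M) i := by
  refine forall_congr' fun p => ?_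
  rw [IsLocalization.AtPrime.ringKrullDim_eq_height p.asIdeal]
  obtain ⟨h, hh⟩ := ENat.ne_top_iff_exists.mp (Ideal.height_ne_top p.isPrime.ne_top)
  rw [← hh, show min (n : WithBot ℕ∞) ((h : ℕ∞) : WithBot ℕ∞) = (((min n h : ℕ) : ℕ∞) : WithBot ℕ∞)
    by push_cast; rfl, WithBot.coe_le_coe, le_localDepth_iff]
  simp only [lt_min_iff, Nat.cast_lt, and_imp]

omit [IsNoetherianRing R] in
theorem IsCohenMacaulayRing.localDepth_eq (hR : IsCohenMacaulayRing R) (p : PrimeSpectrum R) :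
    localDepth (Localization.AtPrime p.asIdeal) (Localization.AtPrime p.asIdeal) =
      p.asIdeal.height := by
  have := hR p
  rwa [IsLocalization.AtPrime.ringKrullDim_eq_height p.asIdeal, WithBot.coe_inj] at this

variable {C : Type u} [AddCommGroup C] [Module R C]

theorem IsSemidualizing.extVanishes_residueField (hR : IsCohenMacaulayRing R)
    (hC : IsSemidualizing R C) (p : PrimeSpectrum R) {i : ℕ} (hi : (i : ℕ∞) < p.asIdeal.height) :
    ExtVanishes (Localization.AtPrime p.asIdeal) (ResidueField (Localization.AtPrime p.asIdeal))
      (LocalizedModule p.asIdeal.primeCompl C) i := by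
  have := hC.finite
  have h := (hC.localizedModule p.asIdeal.primeCompl).localDepth_le
  refine le_localDepth_iff.mp ((?_ : ((i + 1 : ℕ) : ℕ∞) ≤ _).trans h) i i.lt_succ_self
  rw [hR.localDepth_eq p]
  exact_mod_cast Order.add_one_le_of_lt hi

theorem IsSemidualizing.summand_extVanishes_residueField (hR : IsCohenMacaulayRing R)
    (hC : IsSemidualizing R C) {P : Type u} [AddCommGroup P] [Module R P]
    (hP : IsSummandOfCopies R C P) (p : PrimeSpectrum R) {i : ℕ}
    (hi : (i : ℕ∞) < p.asIdeal.height) :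
    ExtVanishes (Localization.AtPrime p.asIdeal) (ResidueField (Localization.AtPrime p.asIdeal))
      (LocalizedModule p.asIdeal.primeCompl P) i := by
  obtain ⟨k, s, r, h⟩ := hP.localizedModule p.asIdeal.primeCompl
  exact (hC.extVanishes_residueField hR p hi).of_sum_eq_id_right s r h

theorem IsSemidualizing.summand_extVanishes (hC : IsSemidualizing R C) {P : Type u}
    [AddCommGroup P] [Module R P] (hP : IsSummandOfCopies R C P) (S : Submonoid R) {i : ℕ}
    (hi : 0 < i) :
    ExtVanishes (Localization S) (LocalizedModule S P) (LocalizedModule S C) i := by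
  obtain ⟨k, s, r, h⟩ := hP.localizedModule S
  exact ExtVanishes.of_sum_eq_id_left s r h ((hC.localizedModule S).ext_vanishing i hi)

omit [IsNoetherianRing R] in
theorem ExtVanishes.zero_of_injective {X Y M : Type u} [AddCommGroup X] [Module R X]
    [AddCommGroup Y] [Module R Y] [AddCommGroup M] [Module R M] {f : X →ₗ[R] Y}
    (hf : Function.Injective f) (h : ExtVanishes R M Y 0) : ExtVanishes R M X 0 := by
  rw [extVanishes_zero_iff] at h ⊢
  refine subsingleton_of_forall_eq 0 fun φ => LinearMap.ext fun m => hf ?_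
  rw [← LinearMap.comp_apply, Subsingleton.elim (f ∘ₗ φ) 0]
  simp

/-- Over a Cohen-Macaulay ring, `n`-`C`-syzygies satisfy Serre's condition `(S_n)`. -/
theorem IsCSyzygy.satisfiesSerre (hR : IsCohenMacaulayRing R) (hC : IsSemidualizing R C) {n : ℕ}
    {M : Type u} [AddCommGroup M] [Module R M] [Module.Finite R M] (h : IsCSyzygy R C n M) :
    SatisfiesSerre R n M := by
  rw [satisfiesSerre_iff]
  induction n generalizing M with
  | zero => intro p i hi; omega
  | succ n ih =>
    intro p i hi hip
    have := hC.finite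
    obtain ⟨P, N, f, g, hf, hfg, hg, hP, hN⟩ := h.exists_exact
    have := hP.finite
    have : Module.Finite R N := Module.Finite.of_surjective g hg
    have hf' := LocalizedModule.map_injective p.asIdeal.primeCompl f hf
    rcases i with _ | i
    · exact (hC.summand_extVanishes_residueField hR hP p hip).zero_of_injective hf'
    · have hi' : (i : ℕ∞) < p.asIdeal.height :=
        lt_of_le_of_lt (by exact_mod_cast i.le_succ) hip
      exact (ih hN p i (by omega) hi').covariant_left hf'
        (localizedModule_map_exact _ hfg) (LocalizedModule.map_surjective _ g hg)
        (hC.summand_extVanishes_residueField hR hP p hip)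

theorem IsSemidualizing.nontrivial {A : Type u} [CommRing A] [Nontrivial A] {C : Type u}
    [AddCommGroup C] [Module A C] (hC : IsSemidualizing A C) : Nontrivial C := by
  rw [← not_subsingleton_iff_nontrivial, ← Module.annihilator_eq_top_iff (R := A),
    hC.annihilator_eq_bot]
  exact bot_ne_top

theorem not_extVanishes_of_mem_associatedPrimes {M : Type u} [AddCommGroup M] [Module R M]
    {p : Ideal R} [p.IsPrime] (hp : p ∈ associatedPrimes R M) :
    ¬ ExtVanishes (Localization.AtPrime p) (ResidueField (Localization.AtPrime p))
        (LocalizedModule p.primeCompl M) 0 := by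
  obtain ⟨-, f, hf⟩ := (isAssociatedPrime_iff_exists_injective_linearMap _ _).mp
    (Module.associatedPrimes.mem_associatedPrimes_atPrime_of_mem_associatedPrimes hp)
  rw [extVanishes_zero_iff]
  intro h
  have h0 : f = 0 := Subsingleton.elim (h := h) _ _
  obtain ⟨x, hx⟩ := exists_ne (0 : ResidueField (Localization.AtPrime p))
  exact hx (hf (by rw [h0]; rfl))

/-- A module satisfying `(S_1)` embeds into its left approximation by copies of `C`, if `C` has
finite injective dimension at the primes of height zero. -/
theorem injective_left_approximation (hR : IsCohenMacaulayRing R) (hC : IsSemidualizing R C)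
    (hG : SatisfiesG R C 0) {M : Type u} [AddCommGroup M] [Module R M] [Module.Finite R M]
    (hM : SatisfiesSerre R 1 M) {k : ℕ} {f : M →ₗ[R] (Fin k → C)}
    (hf : ∀ φ : M →ₗ[R] C, ∃ ψ : (Fin k → C) →ₗ[R] C, ψ ∘ₗ f = φ) : Function.Injective f := by
  have := hC.finite
  rw [satisfiesSerre_iff] at hM
  rw [← LinearMap.ker_eq_bot]
  by_contra hK
  have : Nontrivial (LinearMap.ker f) := Submodule.nontrivial_iff_ne_bot.mpr hK
  obtain ⟨p, hp⟩ := associatedPrimes.nonempty R (LinearMap.ker f)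
  let ι := (LinearMap.ker f).subtype
  have hι : Function.Injective ι := Subtype.val_injective
  have hpM : p ∈ associatedPrimes R M := IsAssociatedPrime.map_of_injective ι hp hι
  have hprime : p.IsPrime := IsAssociatedPrime.isPrime hp
  let q : PrimeSpectrum R := ⟨p, hprime⟩
  -- An associated prime of `M` has `depth M_𝔭 = 0`, so `(S_1)` forces height zero.
  have hht : p.height = 0 := by
    by_contra h0
    exact not_extVanishes_of_mem_associatedPrimes hpM
      (hM q 0 one_pos (by simpa [pos_iff_ne_zero] using h0))
  have hd : localDepth (Localization.AtPrime p) (Localization.AtPrime p) = (0 : ℕ) := by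
    rw [← Nat.cast_zero] at hht
    rw [← hht]
    exact hR.localDepth_eq q
  have hCp : HasFiniteInjDim (Localization.AtPrime p) (LocalizedModule p.primeCompl C) :=
    hG q 0 hht le_rfl
  have hCsd := hC.localizedModule p.primeCompl
  have := hCsd.nontrivial
  have hι' := LocalizedModule.map_injective p.primeCompl ι hι
  -- In depth zero `Ext¹(-, C_𝔭) = 0`, so a map from the localized kernel extends to `M_𝔭`. Up to a
  -- denominator it comes from a map `M → C`, which factors through `f` and kills the kernel.
  have hKC : ExtVanishes (Localization.AtPrime p) (LocalizedModule p.primeCompl (LinearMap.ker f))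
      (LocalizedModule p.primeCompl C) 0 := by
    rw [extVanishes_zero_iff]
    refine subsingleton_of_forall_eq 0 fun φ => ?_
    obtain ⟨ψ, rfl⟩ := ExtVanishes.exists_extension hι' (LinearMap.exact_map_mkQ_range _)
      (Submodule.mkQ_surjective _) (by simpa using hCp.extVanishes hd one_pos _ inferInstance) φ
    obtain ⟨s, ψ₀, hψ⟩ := localizedModule_exists_smul_eq_map p.primeCompl ψ
    obtain ⟨χ, rfl⟩ := hf ψ₀
    have hz : (χ ∘ₗ f) ∘ₗ ι = 0 := by
      ext x
      simp [ι]
    ext x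
    refine IsLocalizedModule.smul_injective (LocalizedModule.mkLinearMap p.primeCompl C) s ?_
    change s • ψ (LocalizedModule.map p.primeCompl ι x) = s • (0 : LocalizedModule p.primeCompl C)
    rw [← LinearMap.smul_apply, ← hψ, ← LinearMap.comp_apply, ← localizedModule_map_comp, hz]
    simp
  -- The residue field embeds in the localized kernel, so its maps to `C_𝔭` would extend and vanish,
  -- against `Ext^0(k, C_𝔭) ≠ 0`.
  obtain ⟨g, hg⟩ := exists_injective_of_not_extVanishes
    (not_extVanishes_of_mem_associatedPrimes hp)
  exact hCp.not_extVanishes hd (hKC.contravariant_left hg (LinearMap.exact_map_mkQ_range g)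
    (Submodule.mkQ_surjective _) (by simpa using hCp.extVanishes hd one_pos _ inferInstance))

/-- The cokernel of an injective left approximation of an `(S_{n+1})`-module satisfies `(S_n)`. -/
theorem satisfiesSerre_of_left_approximation (hR : IsCohenMacaulayRing R)
    (hC : IsSemidualizing R C) {n : ℕ} (hG : SatisfiesG R C n) {M P N : Type u} [AddCommGroup M]
    [Module R M] [Module.Finite R M] [AddCommGroup P] [Module R P] [AddCommGroup N] [Module R N]
    (hM : SatisfiesSerre R (n + 1) M) (hP : IsSummandOfCopies R C P)
    {f : M →ₗ[R] P} {g : P →ₗ[R] N} (hf : Function.Injective f) (hfg : Function.Exact f g)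
    (hg : Function.Surjective g) (hext : ∀ φ : M →ₗ[R] C, ∃ ψ : P →ₗ[R] C, ψ ∘ₗ f = φ) :
    SatisfiesSerre R n N := by
  have := hC.finite
  have := hP.finite
  have : Module.Finite R N := Module.Finite.of_surjective g hg
  rw [satisfiesSerre_iff] at hM ⊢
  intro p i hin hip
  obtain ⟨h, hh⟩ := ENat.ne_top_iff_exists.mp (Ideal.height_ne_top p.isPrime.ne_top)
  have hf' := LocalizedModule.map_injective p.asIdeal.primeCompl f hf
  have hfg' := localizedModule_map_exact p.asIdeal.primeCompl hfg
  have hg' := LocalizedModule.map_surjective p.asIdeal.primeCompl g hg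
  have hstep : ∀ j : ℕ, j < n → j + 1 < h →
      ExtVanishes (Localization.AtPrime p.asIdeal) (ResidueField (Localization.AtPrime p.asIdeal))
        (LocalizedModule p.asIdeal.primeCompl N) j := fun j hjn hjh =>
    (hC.summand_extVanishes_residueField hR hP p
      (by rw [← hh]; exact_mod_cast (by omega : j < h))).covariant_right hf' hfg' hg'
      (hM p (j + 1) (by omega) (by rw [← hh]; exact_mod_cast hjh))
  rw [← hh, Nat.cast_lt] at hip
  -- The depth count `hstep` misses only degree `h - 1`, which matters only when `h ≤ n`.
  by_cases hhn : h ≤ n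
  · have hCp := hG p h hh.symm (by exact_mod_cast hhn)
    have hd := hR.localDepth_eq p
    rw [← hh] at hd
    have := (hC.localizedModule p.asIdeal.primeCompl).nontrivial
    refine hCp.depth_of_extVanishes hd (fun j hj => ?_) (fun j hj => hstep j (by omega) hj) hip
    rcases j with _ | _ | j
    · omega
    -- Degree one is the approximation property; higher degrees use `depth M_𝔭 ≥ h`.
    · refine ExtVanishes.localizedModule _ one_pos
        (ExtVanishes.one_of_forall_extension hf hfg hg ?_ hext)
      obtain ⟨k, s, r, hsr⟩ := hP.exists_sum_eq_id
      exact ExtVanishes.of_sum_eq_id_left s r hsr (hC.ext_vanishing 1 one_pos)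
    · refine ExtVanishes.contravariant_right hf' hfg' hg' (ExtVanishes.of_depth h
        (fun i hi => hM p i (by omega) (by rw [← hh]; exact_mod_cast hi))
        fun X _ _ hX => hCp.extVanishes hd j.succ_pos X hX)
        (hC.summand_extVanishes hP _ (Nat.succ_pos _))
  · exact hstep i hin (by omega)

/-- If `C` has finite injective dimension at all primes of height less than `n`, modules
satisfying `(S_n)` are `n`-`C`-syzygies. -/
theorem SatisfiesSerre.isCSyzygy (hR : IsCohenMacaulayRing R) (hC : IsSemidualizing R C) {n : ℕ}
    (hG : SatisfiesG R C ((n : ℤ) - 1)) {M : Type u} [AddCommGroup M] [Module R M]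
    [Module.Finite R M] (hM : SatisfiesSerre R n M) : IsCSyzygy R C n M := by
  have := hC.finite
  induction n generalizing M with
  | zero => exact isCSyzygy_zero M
  | succ n ih =>
    have hG' : SatisfiesG R C n := by simpa using hG
    obtain ⟨k, f, hf⟩ := exists_left_approximation (R := R) C M
    have hinj : Function.Injective f := by
      refine injective_left_approximation hR hC (fun p h hp hh => hG' p h hp (by omega)) ?_ hf
      rw [satisfiesSerre_iff] at hM ⊢
      exact fun p i hi => hM p i (by omega)
    have hP := isSummandOfCopies_pi (A := R) C k
    exact isCSyzygy_succ_of_exact hinj (LinearMap.exact_map_mkQ_range f)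
      (Submodule.mkQ_surjective _) hP
      (ih (fun p h hp hh => hG' p h hp (by omega)) (satisfiesSerre_of_left_approximation hR hC hG'
        hM hP hinj (LinearMap.exact_map_mkQ_range f) (Submodule.mkQ_surjective _) hf))

theorem IsLocalCanonicalModule.nontrivial {A : Type u} [CommRing A] [IsLocalRing A] {W : Type u}
    [AddCommGroup W] [Module A W] (hW : IsLocalCanonicalModule A W) : Nontrivial W := by
  rw [← not_subsingleton_iff_nontrivial]
  intro h
  obtain ⟨t, -, ⟨e⟩⟩ := hW.type_one
  have := extVanishes_of_subsingleton_right (A := A) (M := ResidueField A) (N := W) t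
  exact not_subsingleton _ e.symm.toEquiv.subsingleton

/-- If a canonical module is an `n`-`C`-syzygy, then `C` has finite injective dimension at all
primes of height less than `n`. -/
theorem IsCanonicalModule.satisfiesG (hR : IsCohenMacaulayRing R) {W : Type u} [AddCommGroup W]
    [Module R W] (hW : IsCanonicalModule R W) (hC : IsSemidualizing R C) {n : ℕ}
    (hsyz : IsCSyzygy R C n W) : SatisfiesG R C ((n : ℤ) - 1) := by
  intro p h hh hhn
  obtain ⟨n, rfl⟩ := Nat.exists_eq_succ_of_ne_zero (by omega : n ≠ 0)
  have := hC.finite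
  have := hW.finite
  have hWp := hW.localCanonical p
  have := hWp.nontrivial
  obtain ⟨P, N, f, g, hf, hfg, hg, hP, hN⟩ := hsyz.exists_exact
  have := hP.finite
  have : Module.Finite R N := Module.Finite.of_surjective g hg
  have hNS := satisfiesSerre_iff.mp (hN.satisfiesSerre hR hC)
  have hd := hR.localDepth_eq p
  rw [hh] at hd
  have hext : ExtVanishes (Localization.AtPrime p.asIdeal)
      (LocalizedModule p.asIdeal.primeCompl N) (LocalizedModule p.asIdeal.primeCompl W) 1 :=
    -- `N` satisfies the Serre condition of an index at least `h`, so `depth N_𝔭 ≥ h`; the vanishing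
    -- of `Ext^{1+h}(-, ω_𝔭)` descends to degree one.
    ExtVanishes.of_depth h
      (fun i hi => hNS p i (by omega) (by rw [hh]; exact_mod_cast hi))
      fun X _ _ hX => hWp.finiteInjDim.extVanishes hd one_pos X hX
  obtain ⟨ρ, hρ⟩ := hext.exists_extension (LocalizedModule.map_injective p.asIdeal.primeCompl f hf)
    (localizedModule_map_exact _ hfg) (LocalizedModule.map_surjective _ g hg) LinearMap.id
  obtain ⟨k, s, r, hsr⟩ := hP.localizedModule p.asIdeal.primeCompl
  obtain ⟨i, q, hqi⟩ := exists_retract_of_sum_eq_id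
    (hC.localizedModule p.asIdeal.primeCompl).homothety.2
    (fun j => s j ∘ₗ LocalizedModule.map p.asIdeal.primeCompl f) (fun j => ρ ∘ₗ r j) (by
      ext w
      have := congrArg ρ (LinearMap.congr_fun hsr (LocalizedModule.map p.asIdeal.primeCompl f w))
      simp only [LinearMap.sum_apply, LinearMap.comp_apply, map_sum, LinearMap.id_apply] at this ⊢
      rw [this]
      exact LinearMap.congr_fun hρ w)
  exact hWp.finiteInjDim.of_retract i q hqi

omit [IsNoetherianRing R] in
theorem IsCanonicalModule.satisfiesSerre {W : Type u} [AddCommGroup W] [Module R W]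
    (hW : IsCanonicalModule R W) (n : ℕ) : SatisfiesSerre R n W := fun p => by
  rw [(hW.localCanonical p).maximalCohenMacaulay]
  exact min_le_right _ _

theorem tfae_satisfiesG_serreClass_cSyzygyClass (hR : IsCohenMacaulayRing R) {W : Type u}
    [AddCommGroup W] [Module R W] (hW : IsCanonicalModule R W) (hC : IsSemidualizing R C) (n : ℕ) :
    [SatisfiesG R C ((n : ℤ) - 1),
      serreClass R n = cSyzygyClass R C n,
      ModuleCat.of R W ∈ cSyzygyClass R C n].TFAE := by
  tfae_have 1 → 2 := fun hG => by
    ext M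
    exact ⟨fun ⟨h1, h2⟩ => ⟨h1, h2.isCSyzygy hR hC hG⟩,
      fun ⟨h1, h2⟩ => ⟨h1, h2.satisfiesSerre hR hC⟩⟩
  tfae_have 2 → 3 := fun h => h ▸ ⟨hW.finite, hW.satisfiesSerre n⟩
  tfae_have 3 → 1 := fun h => hW.satisfiesG hR hC h.2
  tfae_finish

omit [IsNoetherianRing R] in
theorem hasFiniteInjDim_localizedModule_self_iff (S : Submonoid R) :
    HasFiniteInjDim (Localization S) (LocalizedModule S R) ↔
      IsGorensteinLocal (Localization S) := by
  let e : LocalizedModule S R ≃ₗ[Localization S] Localization S :=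
    LinearEquiv.extendScalarsOfIsLocalization S (Localization S)
      (IsLocalizedModule.linearEquiv S (LocalizedModule.mkLinearMap S R)
        (Algebra.linearMap R (Localization S)))
  exact ⟨fun h => h.of_retract e.symm.toLinearMap e.toLinearMap (by ext; simp),
    fun h => h.of_retract e.toLinearMap e.symm.toLinearMap (by ext; simp)⟩

theorem satisfiesG_self_iff (n : ℕ) : SatisfiesG R R ((n : ℤ) - 1) ↔
    ∀ p : PrimeSpectrum R, p.asIdeal.height < n →
      IsGorensteinLocal (Localization.AtPrime p.asIdeal) := by
  refine forall_congr' fun p => ?_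
  simp only [hasFiniteInjDim_localizedModule_self_iff]
  obtain ⟨h, hh⟩ := ENat.ne_top_iff_exists.mp (Ideal.height_ne_top p.isPrime.ne_top)
  rw [← hh]
  constructor
  · intro H hlt
    have : h < n := by exact_mod_cast hlt
    exact H h rfl (by omega)
  · intro H h' heq hle
    obtain rfl : h = h' := by exact_mod_cast heq
    exact H (by exact_mod_cast (by omega : h < n))

end CohenMacaulay

theorem theorem4p1 (R : Type u) [CommRing R] [IsNoetherianRing R] (hR : IsCohenMacaulayRing R)
    (W : Type u) [AddCommGroup W] [Module R W] (hW : IsCanonicalModule R W) (n : ℕ) :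
    (∀ (C : Type u) [AddCommGroup C] [Module R C], IsSemidualizing R C →
      [SatisfiesG R C ((n : ℤ) - 1),
        serreClass R n = cSyzygyClass R C n,
        ModuleCat.of R W ∈ cSyzygyClass R C n].TFAE) ∧
    [∀ p : PrimeSpectrum R, p.asIdeal.height < n →
        IsGorensteinLocal (Localization.AtPrime p.asIdeal),
      serreClass R n = cSyzygyClass R R n,
      ModuleCat.of R W ∈ cSyzygyClass R R n].TFAE := by
  refine ⟨fun C _ _ hC => tfae_satisfiesG_serreClass_cSyzygyClass hR hW hC n, ?_⟩
  rw [← satisfiesG_self_iff]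
  exact tfae_satisfiesG_serreClass_cSyzygyClass hR hW isSemidualizing_self n
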